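/- For a non-empty finite subset $A$ of an abelian group, let $\sigma(A) = |A+A|/|A|$, where $A+A=\{a+a' : a,a'\in A\}$. For a real number $K$, let $F(K)$ denote the least positive real constant such that for every integer $m \ge 1$, every non-empty set $A \subseteq \mathbb{F}_2^m$ with $\sigma(A) \le K$ is contained in an affine subspace $V \subseteq \mathbb{F}_2^m$ of cardinality $|V| \le F(K)\,|A|$. Then for every $K$ with $1 \le K < 2$ this least constant exists, and $$F(K)=\begin{cases} K & \text{if } 1 \le K < \tfrac74,\\[2pt] \tfrac87 K & \text{if } \tfrac74 \le K < 2.\end{cases}$$ -/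

import Mathlib

open scoped Pointwise Combinatorics.Additive

/-- `IsCoveringConstant K C`: the constant `C` is positive, and for every `m ≥ 1`, every non-empty
`A ⊆ 𝔽₂ᵐ` whose doubling constant `σ[A] = |A + A| / |A|` is at most `K` is contained in some affine
subspace `V ⊆ 𝔽₂ᵐ` of cardinality `|V| ≤ C * |A|`. -/
def IsCoveringConstant (K C : ℝ) : Prop :=
  0 < C ∧ ∀ m : ℕ, 0 < m → ∀ A : Finset (Fin m → ZMod 2), A.Nonempty → (σ[A] : ℝ) ≤ K →
    ∃ V : AffineSubspace (ZMod 2) (Fin m → ZMod 2),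
      (A : Set (Fin m → ZMod 2)) ⊆ (V : Set (Fin m → ZMod 2)) ∧
        (Nat.card V : ℝ) ≤ C * (A.card : ℝ)

/-- The Green–Tao constant `F(K)`. As an infimum it is the least covering constant exactly when it
is itself one; the theorem asserts this together with the value. -/
noncomputable def greenTaoConstant (K : ℝ) : ℝ :=
  sInf {C : ℝ | IsCoveringConstant K C}

/-!
The proof identifies the sumsets of small doubling in `𝔽₂ⁿ`. After a translation and a change of
coordinates a set `A` contains zero and the standard basis of `𝔽₂ⁿ`, and the point is that
`|A + A| < 2 |A|` forces `|A + A| ≥ 7/8 * 2 ^ n` (`ContainsBasis.seven_mul_two_pow_le`). This gives the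
upper bound `8/7 * K` at once. It also gives the bound `K` below `7/4`: if `A + A` misses a point `z`,
then `A` and `A + z` are disjoint, so `2 |A| ≤ 2 ^ n` and the doubling of `A` is at least `7/4`.

For the density bound, coordinate compressions (`cubeCompress`) preserve `|A|`, do not increase
`|A + A|` and keep the basis in `A`, so `A` may be taken to be a down-set
(`ContainsBasis.exists_isDownSet`). For down-sets of doubling less than two,
`IsDownSet.add_self_eq_univ_or_isCosetCompl` shows by induction on `n` that `A + A` misses nothing or
exactly one coset `c + H`. The sections `A₁ ⊆ A₀` of `A` in the direction of a coordinate satisfy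
`|A₀ + A₀| + |A₀ + A₁| < 2 |A₀| + 2 |A₁|`, and the sections of `A + A` are `A₀ + A₀` and `A₀ + A₁`.
Kneser's theorem (`kneser`) for the pair `A₀, A₁` yields `|A₀ + A₀| < 2 |A₀|`, so that induction applies
to `A₀`, and then:
* if `A₀ + A₀` is everything, `A₀ + A₁` misses at most one coset
  (`exists_isCosetCompl_of_card_lt`);
* if `A₀ + A₀` misses a coset, `A₀ + A₁` misses the same coset (`isCosetCompl_of_nested`).
Finally the index of `H` is at least `8`, since `A` generates and `c ∉ A + A`
(`eight_mul_card_le_of_isCosetCompl`).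

For the lower bounds (`IsCoveringConstant.le_mul`), take dense generating subsets of the whole space
or, when `K ≥ 7/4`, of the set of points with at most one nonzero coordinate among the first three,
whose sumset has density `7/8`.
-/

open Finset

/-! ### Kneser's theorem -/

section Kneser

variable {G : Type*} [AddCommGroup G] [Fintype G]

open Classical in
/-- The elements of a subgroup of a finite group, as a finset. -/
noncomputable def AddSubgroup.elems (H : AddSubgroup G) : Finset G := univ.filter (· ∈ H)

@[simp] lemma AddSubgroup.mem_elems {H : AddSubgroup G} {x : G} : x ∈ H.elems ↔ x ∈ H := by
  simp [AddSubgroup.elems]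

lemma AddSubgroup.card_elems (H : AddSubgroup G) : #H.elems = Nat.card H := by
  classical
  rw [Nat.card_eq_fintype_card, ← Fintype.card_coe]
  exact Fintype.card_congr (Equiv.subtypeEquivRight fun _ ↦ AddSubgroup.mem_elems)

lemma AddSubgroup.elems_mono {H K : AddSubgroup G} (h : H ≤ K) : H.elems ⊆ K.elems :=
  fun _ hx => AddSubgroup.mem_elems.2 (h (AddSubgroup.mem_elems.1 hx))

lemma AddSubgroup.card_elems_pos (H : AddSubgroup G) : 0 < #H.elems :=
  card_pos.2 ⟨0, by simp⟩

variable [DecidableEq G]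

/-- `C` is a union of cosets of the subgroup `H` (which need not be the full stabilizer of `C`). -/
def IsPeriodic (H : AddSubgroup G) (C : Finset G) : Prop :=
  ∀ x ∈ C, ∀ h ∈ H, x + h ∈ C

/-- Inside the coset `c + H₁ + H₂`, an `H₁`-periodic set is a union of rows and an `H₂`-periodic
set a union of columns of a grid, each of whose cells is a coset of `H₁ ⊓ H₂`. This counts the
cells in the difference. -/
lemma card_mul_card_le_card_sdiff {H₁ H₂ : AddSubgroup G} {C₁ C₂ : Finset G}
    (h₁ : IsPeriodic H₁ C₁) (h₂ : IsPeriodic H₂ C₂) (c : G) :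
    #(H₂.elems.filter fun y => c + y ∈ C₁) * #(H₁.elems.filter fun x => c + x ∉ C₂) ≤
      #(H₁ ⊓ H₂).elems * #(C₁ \ C₂) := by
  rw [← card_product]
  apply card_le_mul_card_image_of_maps_to (f := fun p : G × G => c + p.1 + p.2)
  · rintro ⟨y, x⟩ h
    simp only [mem_product, mem_filter, AddSubgroup.mem_elems] at h
    obtain ⟨⟨hy, hyC⟩, hx, hxC⟩ := h
    refine mem_sdiff.2 ⟨h₁ _ hyC _ hx, fun h => hxC ?_⟩
    have := h₂ _ h _ (neg_mem hy)
    convert this using 1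
    abel
  · intro b _
    -- two points of a fibre differ by an element of `H₁ ⊓ H₂`
    rcases (filter (fun p : G × G => c + p.1 + p.2 = b)
      (filter (fun y => c + y ∈ C₁) H₂.elems ×ˢ filter (fun x => c + x ∉ C₂) H₁.elems)
      ).eq_empty_or_nonempty with h | ⟨⟨y₀, x₀⟩, h⟩
    · rw [h]; simp
    simp only [mem_product, mem_filter, AddSubgroup.mem_elems] at h
    apply card_le_card_of_injOn (fun p => p.2 - x₀)
    · rintro ⟨y, x⟩ h'
      simp only [coe_filter, mem_product, mem_filter, AddSubgroup.mem_elems,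
        Set.mem_ofPred_eq] at h'
      simp only [mem_coe, AddSubgroup.mem_elems, AddSubgroup.mem_inf]
      refine ⟨sub_mem h'.1.2.1 h.1.2.1, ?_⟩
      have e : x - x₀ = y₀ - y := by
        have := h'.2.trans h.2.symm
        rw [add_assoc, add_assoc, add_right_inj] at this
        rw [sub_eq_sub_iff_add_eq_add, add_comm, this]
      rw [e]
      exact sub_mem h.1.1.1 h'.1.1.1
    · rintro ⟨y, x⟩ hp ⟨y', x'⟩ hp' e
      simp only [coe_filter, Set.mem_ofPred_eq] at hp hp'
      have e : x = x' := by simpa using e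
      subst e
      have := hp.2.trans hp'.2.symm
      simp at this
      rw [this]

/-- If the deficiencies of `C₁` and `C₂` in their union are both small, then inside any coset of
`H₁ + H₂` that meets `C₁ \ C₂` the set `C₂` is absent, so that `C₁ \ C₂` contains a coset of `H₁`. -/
lemma card_le_card_sdiff_of_isPeriodic {H₁ H₂ : AddSubgroup G} {C₁ C₂ : Finset G}
    (h₁ : IsPeriodic H₁ C₁) (h₂ : IsPeriodic H₂ C₂)
    (d₁ : #(C₁ \ C₂) + #(H₁ ⊓ H₂).elems < #H₂.elems)
    (d₂ : #(C₂ \ C₁) + #(H₁ ⊓ H₂).elems < #H₁.elems)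
    {c : G} (hc₁ : c ∈ C₁) (hc₂ : c ∉ C₂) : #H₁.elems ≤ #(C₁ \ C₂) := by
  have k₁ := card_mul_card_le_card_sdiff h₁ h₂ c
  have k₂ := card_mul_card_le_card_sdiff h₂ h₁ c
  rw [inf_comm H₂ H₁] at k₂
  have s₁ := card_filter_add_card_filter_not (s := H₁.elems) (fun x => c + x ∈ C₂)
  have s₂ := card_filter_add_card_filter_not (s := H₂.elems) (fun x => c + x ∈ C₁)
  set l := #(H₁ ⊓ H₂).elems with hl
  have lpos : 0 < l := AddSubgroup.card_elems_pos _
  have hu₁ : l ≤ #(H₂.elems.filter fun y => c + y ∈ C₁) := by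
    refine card_le_card fun y hy => ?_
    simp only [AddSubgroup.mem_elems, AddSubgroup.mem_inf] at hy
    simp only [mem_filter, AddSubgroup.mem_elems]
    exact ⟨hy.2, h₁ _ hc₁ _ hy.1⟩
  have hp : l ≤ #(H₁.elems.filter fun y => c + y ∉ C₂) := by
    refine card_le_card fun y hy => ?_
    simp only [AddSubgroup.mem_elems, AddSubgroup.mem_inf] at hy
    simp only [mem_filter, AddSubgroup.mem_elems]
    exact ⟨hy.1, fun h => hc₂ (by simpa using h₂ _ h _ (neg_mem hy.2))⟩
  have hu₂ : #(H₁.elems.filter fun y => c + y ∈ C₂) = 0 ∨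
      l ≤ #(H₁.elems.filter fun y => c + y ∈ C₂) := by
    rcases (H₁.elems.filter fun y => c + y ∈ C₂).eq_empty_or_nonempty with h | ⟨x, hx⟩
    · left; rw [h]; rfl
    right
    simp only [mem_filter, AddSubgroup.mem_elems] at hx
    refine card_le_card_of_injOn (fun y => x + y) (fun y hy => ?_) (fun _ _ _ _ h => by simpa using h)
    simp only [mem_coe, AddSubgroup.mem_elems, AddSubgroup.mem_inf] at hy
    simp only [AddSubgroup.mem_elems, coe_filter, Set.mem_ofPred_eq]
    exact ⟨add_mem hx.1 hy.1, by rw [← add_assoc]; exact h₂ _ hx.2 _ hy.2⟩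
  generalize #(H₂.elems.filter fun y => c + y ∈ C₁) = u₁ at *
  generalize #(H₁.elems.filter fun y => c + y ∉ C₂) = p at *
  generalize #(H₁.elems.filter fun y => c + y ∈ C₂) = u₂ at *
  generalize #(H₂.elems.filter fun y => c + y ∉ C₁) = q at *
  generalize #H₁.elems = m₁ at *
  generalize #H₂.elems = m₂ at *
  generalize #(C₁ \ C₂) = e₁ at *
  generalize #(C₂ \ C₁) = e₂ at *
  -- now `m₁ = u₂ + p`, `m₂ = u₁ + q`
  rcases hu₂ with rfl | hu₂
  · have : l * p ≤ l * e₁ := (Nat.mul_le_mul_right p hu₁).trans k₁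
    have := Nat.le_of_mul_le_mul_left this lpos
    omega
  · exfalso
    subst s₁ s₂
    zify at *
    have hq : p < q := by
      by_contra! hqp
      have : (u₁ : ℤ) * (p - l) < l * (q - l) := by nlinarith
      nlinarith
    have : (u₂ : ℤ) * (q - l) < l * (p - l) := by nlinarith
    nlinarith

/-- Kneser's union lemma, for sets periodic under given subgroups. -/
lemma exists_isPeriodic_union {H₁ H₂ : AddSubgroup G} {C₁ C₂ : Finset G}
    (h₁ : IsPeriodic H₁ C₁) (h₂ : IsPeriodic H₂ C₂) {t : ℕ}
    (t₁ : t ≤ #C₁ + #H₁.elems) (t₂ : t ≤ #C₂ + #H₂.elems) :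
    ∃ H : AddSubgroup G, IsPeriodic H (C₁ ∪ C₂) ∧ t ≤ #(C₁ ∪ C₂) + #H.elems := by
  by_cases h12 : C₁ ⊆ C₂
  · exact ⟨H₂, by rwa [union_eq_right.2 h12], by rwa [union_eq_right.2 h12]⟩
  by_cases h21 : C₂ ⊆ C₁
  · exact ⟨H₁, by rwa [union_eq_left.2 h21], by rwa [union_eq_left.2 h21]⟩
  refine ⟨H₁ ⊓ H₂, ?_, ?_⟩
  · intro x hx h hh
    rcases mem_union.1 hx with hx | hx
    · exact mem_union_left _ (h₁ _ hx _ hh.1)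
    · exact mem_union_right _ (h₂ _ hx _ hh.2)
  by_contra! hlt
  have c₁ : #(C₁ \ C₂) + #C₂ = #(C₁ ∪ C₂) := card_sdiff_add_card _ _
  have c₂ : #(C₂ \ C₁) + #C₁ = #(C₁ ∪ C₂) := by rw [union_comm]; exact card_sdiff_add_card _ _
  obtain ⟨x, hx₁, hx₂⟩ := not_subset.1 h12
  obtain ⟨y, hy₁, hy₂⟩ := not_subset.1 h21
  have a := card_le_card_sdiff_of_isPeriodic h₁ h₂ (by omega) (by omega) hx₁ hx₂
  have b := card_le_card_sdiff_of_isPeriodic h₂ h₁ (by rw [inf_comm]; omega)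
    (by rw [inf_comm]; omega) hy₁ hy₂
  omega

/-- Every sum `a + b` lies in a periodic subset of `A + B` that is large compared with its period.
Dyson transforms fixing the pair `(a, b)` shrink `B` until `A + (B - b) = A`. -/
lemma exists_isPeriodic_subset_add (n : ℕ) : ∀ A B : Finset G, #B ≤ n → ∀ a ∈ A, ∀ b ∈ B,
    ∃ C : Finset G, C ⊆ A + B ∧ a + b ∈ C ∧
      ∃ H : AddSubgroup G, IsPeriodic H C ∧ #A + #B ≤ #C + #H.elems := by
  induction n with
  | zero =>
    intro A B hB a _ b hb
    simp only [nonpos_iff_eq_zero, card_eq_zero] at hB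
    simp [hB] at hb
  | succ n ih =>
    intro A B hB a ha b hb
    by_cases h : ∃ e, e + b ∈ A ∧ ¬ e +ᵥ B ⊆ A
    · -- transform by `e`; the pair `(a, b)` survives
      obtain ⟨e, heA, heB⟩ := h
      have hlt : #(B ∩ (-e +ᵥ A)) < #B := by
        refine card_lt_card ⟨inter_subset_left, fun hsub => heB fun x hx => ?_⟩
        obtain ⟨y, hy, rfl⟩ := mem_vadd_finset.1 hx
        obtain ⟨z, hz, hzy⟩ := mem_vadd_finset.1 (mem_inter.1 (hsub hy)).2
        rw [← hzy, vadd_vadd, add_neg_cancel, zero_vadd]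
        exact hz
      obtain ⟨C, hC, hab, H, hH, hcard⟩ := ih (A ∪ (e +ᵥ B)) (B ∩ (-e +ᵥ A)) (by omega) a
        (mem_union_left _ ha) b (mem_inter.2 ⟨hb, mem_vadd_finset.2 ⟨e + b, heA, by simp⟩⟩)
      refine ⟨C, hC.trans (addDysonETransform.subset e (A, B)), hab, H, hH, ?_⟩
      exact (addDysonETransform.card e (A, B)).ge.trans hcard
    · -- every translate of `B - b` by an element of `A` stays in `A`, so that `A + b` is periodic
      push Not at h
      have key : ∀ x ∈ A, ∀ y ∈ B, x + (y - b) ∈ A := fun x hx y hy => by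
        have := h (x - b) (by simpa using hx) (vadd_mem_vadd_finset hy)
        rw [vadd_eq_add] at this
        convert this using 1
        abel
      let H : AddSubgroup G := AddSubgroup.closure (((fun y => y - b) '' (B : Set G)))
      have hper : ∀ h ∈ H, ∀ x, x ∈ A ↔ x + h ∈ A := by
        intro h hh
        refine AddSubgroup.closure_induction (p := fun h _ => ∀ x, x ∈ A ↔ x + h ∈ A)
          ?_ ?_ ?_ ?_ hh
        · rintro _ ⟨y, hy, rfl⟩ x
          refine ⟨fun hx => key x hx y hy, fun hx => ?_⟩
          -- translation by `y - b` is injective on the finite set `A`, hence onto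
          have hsub : A.image (fun z => z + (y - b)) ⊆ A :=
            image_subset_iff.2 fun z hz => key z hz y hy
          have heq := eq_of_subset_of_card_le hsub
            (card_image_of_injective _ (add_left_injective _)).ge
          rw [← heq] at hx
          obtain ⟨z, hz, hzx⟩ := mem_image.1 hx
          rwa [← add_right_cancel hzx]
        · simp
        · intro g k _ _ hg hk x
          rw [← add_assoc, hg x, hk]
        · intro g _ hg x
          rw [hg (x + -g)]; simp
      refine ⟨b +ᵥ A, ?_, mem_vadd_finset.2 ⟨a, ha, add_comm _ _⟩, H, ?_, ?_⟩
      · intro x hx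
        obtain ⟨z, hz, rfl⟩ := mem_vadd_finset.1 hx
        rw [vadd_eq_add, add_comm b]
        exact add_mem_add hz hb
      · intro x hx g hg
        obtain ⟨z, hz, rfl⟩ := mem_vadd_finset.1 hx
        refine mem_vadd_finset.2 ⟨z + g, (hper g hg z).1 hz, ?_⟩
        simp [add_assoc]
      · rw [card_vadd_finset]
        refine Nat.add_le_add_left ?_ _
        refine card_le_card_of_injOn (fun y => y - b) (fun y hy => ?_)
          (fun _ _ _ _ h => by simpa using h)
        simp only [mem_coe, AddSubgroup.mem_elems]
        exact AddSubgroup.subset_closure ⟨y, hy, rfl⟩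

/-- A weak form of Kneser's theorem, without the periodic hulls of `A` and `B`. The sumset is the union
of the large periodic sets through its points. -/
lemma exists_isPeriodic_add {A B : Finset G} (hA : A.Nonempty) (hB : B.Nonempty) :
    ∃ H : AddSubgroup G, IsPeriodic H (A + B) ∧ #A + #B ≤ #(A + B) + #H.elems := by
  have key : ∀ c ∈ A + B, ∃ C : Finset G, C ⊆ A + B ∧ c ∈ C ∧
      ∃ H : AddSubgroup G, IsPeriodic H C ∧ #A + #B ≤ #C + #H.elems := by
    intro c hc
    obtain ⟨a, ha, b, hb, rfl⟩ := mem_add.1 hc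
    exact exists_isPeriodic_subset_add _ A B le_rfl a ha b hb
  choose! f hsub hmem hper using key
  have hsup : (A + B).sup' (hA.add hB) f = A + B := by
    apply le_antisymm
    · exact sup'_le _ _ hsub
    · exact fun c hc => (le_sup' f hc : f c ≤ _) (hmem c hc)
  rw [← hsup]
  refine sup'_induction (p := fun C => ∃ H : AddSubgroup G, IsPeriodic H C ∧
    #A + #B ≤ #C + #H.elems) _ _ ?_ hper
  rintro C₁ ⟨H₁, h₁, t₁⟩ C₂ ⟨H₂, h₂, t₂⟩
  exact exists_isPeriodic_union h₁ h₂ t₁ t₂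

/-- **Kneser's theorem** in a finite abelian group. -/
theorem kneser {A B : Finset G} (hA : A.Nonempty) (hB : B.Nonempty) :
    ∃ K : AddSubgroup G, IsPeriodic K (A + B) ∧
      #(A + K.elems) + #(B + K.elems) ≤ #(A + B) + #K.elems := by
  -- `K` is the full stabilizer of `A + B`
  let K : AddSubgroup G :=
    { carrier := {k | ∀ x, x ∈ A + B ↔ x + k ∈ A + B}
      zero_mem' := by simp
      add_mem' := by
        intro g k hg hk x
        rw [← add_assoc, hg x, hk]
      neg_mem' := by
        intro g hg x
        rw [hg (x + -g)]; simp }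
  have hK : IsPeriodic K (A + B) := fun x hx k hk => (hk x).1 hx
  have hKK : K.elems + K.elems = K.elems := by
    apply Subset.antisymm
    · intro x hx
      obtain ⟨a, ha, b, hb, rfl⟩ := mem_add.1 hx
      simp only [AddSubgroup.mem_elems] at ha hb ⊢
      exact add_mem ha hb
    · intro x hx
      exact mem_add.2 ⟨x, hx, 0, by simp, by simp⟩
  -- apply the weak form to the periodic hulls of `A` and `B`, which have the same sumset
  have hsum : (A + K.elems) + (B + K.elems) = A + B := by
    rw [add_add_add_comm, hKK]
    apply Subset.antisymm
    · intro x hx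
      obtain ⟨a, ha, b, hb, rfl⟩ := mem_add.1 hx
      exact hK _ ha _ (AddSubgroup.mem_elems.1 hb)
    · intro x hx
      exact mem_add.2 ⟨x, hx, 0, by simp, by simp⟩
  have hKne : K.elems.Nonempty := ⟨0, by simp⟩
  obtain ⟨H, hH, hcard⟩ := exists_isPeriodic_add (hA.add hKne) (hB.add hKne)
  rw [hsum] at hH hcard
  refine ⟨K, hK, hcard.trans ?_⟩
  gcongr
  refine AddSubgroup.elems_mono fun h hh x => ⟨fun hx => hH x hx h hh, fun hx => ?_⟩
  simpa using hH _ hx _ (neg_mem hh)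

end Kneser

/-! ### Nested pairs of sets in groups of exponent two -/

section ElementaryTwoGroup

lemma IsPeriodic.card_dvd {G : Type*} [AddCommGroup G] [Fintype G] [DecidableEq G]
    {K : AddSubgroup G} {C : Finset G} (h : IsPeriodic K C) : #K.elems ∣ #C := by
  classical
  rw [card_eq_sum_card_image (QuotientAddGroup.mk (s := K)) C]
  refine dvd_sum fun b hb => ?_
  obtain ⟨a, ha, rfl⟩ := mem_image.1 hb
  have : C.filter (fun x => QuotientAddGroup.mk (s := K) x = QuotientAddGroup.mk a) = a +ᵥ K.elems := by
    ext x
    simp only [mem_filter, mem_vadd_finset, AddSubgroup.mem_elems, vadd_eq_add]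
    constructor
    · rintro ⟨_, hx⟩
      exact ⟨-a + x, QuotientAddGroup.eq.1 hx.symm, by simp⟩
    · rintro ⟨k, hk, rfl⟩
      exact ⟨h a ha k hk, QuotientAddGroup.eq.2 (by simpa using hk)⟩
  rw [this, card_vadd_finset]

lemma add_cancel_mid {V : Type*} [AddCommGroup V] (hV : ∀ x : V, x + x = 0) (x y : V) :
    x + (x + y) = y := by rw [← add_assoc, hV, zero_add]

lemma add_cancel_end {V : Type*} [AddCommGroup V] (hV : ∀ x : V, x + x = 0) (x y : V) :
    y + x + x = y := by rw [add_assoc, hV, add_zero]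

variable {V : Type*} [AddCommGroup V] [Fintype V] [DecidableEq V]

lemma isPeriodic_add_elems (A : Finset V) (K : AddSubgroup V) : IsPeriodic K (A + K.elems) := by
  intro x hx k hk
  obtain ⟨a, ha, b, hb, rfl⟩ := mem_add.1 hx
  rw [add_assoc]
  exact add_mem_add ha (AddSubgroup.mem_elems.2 (add_mem (AddSubgroup.mem_elems.1 hb) hk))

lemma subset_add_elems (A : Finset V) (K : AddSubgroup V) : A ⊆ A + K.elems :=
  fun x hx => mem_add.2 ⟨x, hx, 0, by simp, by simp⟩

/-- The lower half of a nested pair inherits small doubling. -/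
lemma card_add_self_lt_of_nested {A₀ A₁ : Finset V} (h₁ : A₁.Nonempty) (hsub : A₁ ⊆ A₀)
    (hlt : #(A₀ + A₀) + #(A₀ + A₁) < 2 * #A₀ + 2 * #A₁) : #(A₀ + A₀) < 2 * #A₀ := by
  by_contra! hge
  obtain ⟨K, hK, hcard⟩ := kneser (h₁.mono hsub) h₁
  -- the numbers below being multiples of `#K`, Kneser's theorem forces `A₀ + K = A₁ + K`
  have hsubK : A₁ + K.elems ⊆ A₀ + K.elems := add_subset_add_right hsub
  have heq : A₁ + K.elems = A₀ + K.elems := by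
    refine eq_of_subset_of_card_le hsubK ?_
    obtain ⟨α, hα⟩ := (isPeriodic_add_elems A₀ K).card_dvd
    obtain ⟨β, hβ⟩ := (isPeriodic_add_elems A₁ K).card_dvd
    have h₃ := card_le_card (subset_add_elems A₁ K)
    have h₄ : #(A₀ + K.elems) < #(A₁ + K.elems) + #K.elems := by omega
    rw [hα, hβ, ← mul_add_one] at h₄
    have := Nat.lt_of_mul_lt_mul_left h₄
    rw [hα, hβ]
    exact Nat.mul_le_mul_left _ (by omega)
  have hle : A₀ + A₀ ⊆ A₀ + A₁ := by
    intro x hx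
    obtain ⟨a, ha, b, hb, rfl⟩ := mem_add.1 hx
    obtain ⟨d, hd, k, hk, rfl⟩ := mem_add.1 (heq ▸ subset_add_elems A₀ K hb)
    rw [← add_assoc]
    exact hK _ (add_mem_add ha hd) _ (AddSubgroup.mem_elems.1 hk)
  have := card_le_card hle
  have := card_le_card hsub
  omega

/-- The complement of `S` is the coset `c + H`. (The membership is written `x + c ∈ H`, which is
the same as `x - c ∈ H` in a group of exponent two.) -/
def IsCosetCompl (S : Finset V) (H : AddSubgroup V) (c : V) : Prop := ∀ x, x ∉ S ↔ x + c ∈ H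

variable (hV : ∀ x : V, x + x = 0)

include hV

lemma card_add_card_le_of_notMem_add {A B : Finset V} {z : V} (hz : z ∉ A + B) :
    #A + #B ≤ Fintype.card V := by
  rw [← card_vadd_finset z B, ← card_union_of_disjoint]
  · exact card_le_univ _
  · rw [disjoint_left]
    intro a ha ha'
    obtain ⟨b, hb, rfl⟩ := mem_vadd_finset.1 ha'
    refine hz (mem_add.2 ⟨_, ha, b, hb, ?_⟩)
    rw [vadd_eq_add, add_cancel_end hV]

lemma IsCosetCompl.card_add {S : Finset V} {H : AddSubgroup V} {c : V} (h : IsCosetCompl S H c) :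
    #S + #H.elems = Fintype.card V := by
  rw [← card_compl_add_card S, add_comm, add_left_inj, ← card_vadd_finset c]
  congr 1
  ext x
  rw [mem_compl, h x, mem_vadd_finset]
  constructor
  · rintro ⟨y, hy, rfl⟩
    rw [vadd_eq_add, add_comm c, add_cancel_end hV]
    exact AddSubgroup.mem_elems.1 hy
  · intro hx
    exact ⟨x + c, AddSubgroup.mem_elems.2 hx, by rw [vadd_eq_add, add_comm, add_cancel_end hV]⟩

/-- If one section of a sumset is everything, the other one misses at most a coset. -/
lemma exists_isCosetCompl_of_card_lt {A₀ A₁ : Finset V} (h₀ : A₀.Nonempty) (h₁ : A₁.Nonempty)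
    (hlt : Fintype.card V + #(A₀ + A₁) < 2 * #A₀ + 2 * #A₁) :
    A₀ + A₁ = univ ∨ ∃ K c, IsCosetCompl (A₀ + A₁) K c := by
  by_cases hu : A₀ + A₁ = univ
  · exact Or.inl hu
  right
  obtain ⟨z, hz⟩ : ∃ z, z ∉ A₀ + A₁ := by
    by_contra! h
    exact hu (eq_univ_iff_forall.2 h)
  obtain ⟨K, hK, hcard⟩ := kneser h₀ h₁
  refine ⟨K, z, ?_⟩
  have hz' : z ∉ (A₀ + K.elems) + (A₁ + K.elems) := by
    intro h
    obtain ⟨x, hx, y, hy, rfl⟩ := mem_add.1 h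
    obtain ⟨a, ha, k, hk, rfl⟩ := mem_add.1 hx
    obtain ⟨b, hb, l, hl, rfl⟩ := mem_add.1 hy
    rw [add_add_add_comm] at hz
    exact hz (hK _ (add_mem_add ha hb) _
      (add_mem (AddSubgroup.mem_elems.1 hk) (AddSubgroup.mem_elems.1 hl)))
  have hle := card_add_card_le_of_notMem_add hV hz'
  have hper : IsPeriodic K (univ \ (A₀ + A₁)) := by
    intro x hx k hk
    refine mem_sdiff.2 ⟨mem_univ _, fun h => (mem_sdiff.1 hx).2 ?_⟩
    simpa using hK _ h _ (neg_mem hk)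
  have hD : #(univ \ (A₀ + A₁)) + #(A₀ + A₁) = Fintype.card V := by
    rw [← card_univ]; exact card_sdiff_add_card_eq_card (subset_univ _)
  have hsub : z +ᵥ K.elems ⊆ univ \ (A₀ + A₁) := by
    intro x hx
    obtain ⟨k, hk, rfl⟩ := mem_vadd_finset.1 hx
    exact hper z (by simpa using hz) k (AddSubgroup.mem_elems.1 hk)
  -- everything in sight is a multiple of `#K`, so `#(A₀ + K) + #(A₁ + K) = #V`
  have hcard' : #(univ \ (A₀ + A₁)) ≤ #K.elems := by
    obtain ⟨α, hα⟩ := (isPeriodic_add_elems A₀ K).card_dvd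
    obtain ⟨β, hβ⟩ := (isPeriodic_add_elems A₁ K).card_dvd
    have huniv : IsPeriodic K (univ : Finset V) := fun _ _ _ _ => mem_univ _
    obtain ⟨ν, hν⟩ := huniv.card_dvd
    rw [card_univ] at hν
    have h₃ := card_le_card (subset_add_elems A₀ K)
    have h₄ := card_le_card (subset_add_elems A₁ K)
    have h₅ : Fintype.card V < #(A₀ + K.elems) + #(A₁ + K.elems) + #K.elems := by omega
    rw [hα, hβ, hν, ← mul_add, ← mul_add_one] at h₅
    have := Nat.lt_of_mul_lt_mul_left h₅
    have h₆ : Fintype.card V ≤ #(A₀ + K.elems) + #(A₁ + K.elems) := by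
      rw [hα, hβ, hν, ← mul_add]
      exact Nat.mul_le_mul_left _ (by omega)
    omega
  have heq := eq_of_subset_of_card_le hsub (by rwa [card_vadd_finset])
  intro x
  rw [← mem_compl, compl_eq_univ_sdiff, ← heq, mem_vadd_finset]
  constructor
  · rintro ⟨k, hk, rfl⟩
    rw [vadd_eq_add, add_comm z, add_cancel_end hV]
    exact AddSubgroup.mem_elems.1 hk
  · intro hx
    exact ⟨x + z, AddSubgroup.mem_elems.2 hx, by rw [vadd_eq_add, add_comm, add_cancel_end hV]⟩

/-- If the sumset `A + A` of a dense enough set misses exactly `c + H`, then `A + H` and its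
translate by `c` partition the group. -/
lemma mem_add_elems_iff_of_isCosetCompl {A : Finset V} {H : AddSubgroup V} {c : V}
    (hS : IsCosetCompl (A + A) H c) (hlt : #(A + A) < 2 * #A) :
    2 * #(A + H.elems) = Fintype.card V ∧
      ∀ x, x + c ∈ A + H.elems ↔ x ∉ A + H.elems := by
  have hdisj : Disjoint (A + H.elems) (c +ᵥ (A + H.elems)) := by
    rw [disjoint_left]
    intro x hx hx'
    obtain ⟨y, hy, rfl⟩ := mem_vadd_finset.1 hx'
    obtain ⟨a, ha, k, hk, rfl⟩ := mem_add.1 hy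
    obtain ⟨b, hb, l, hl, e⟩ := mem_add.1 hx
    rw [AddSubgroup.mem_elems] at hk hl
    refine (hS (a + b)).2 ?_ (add_mem_add ha hb)
    have : a + b + c = k + l := by
      have e2 : b = c + (a + k) + l := by
        rw [vadd_eq_add] at e
        rw [← e, add_cancel_end hV]
      calc a + b + c = (a + a) + (c + c) + (k + l) := by rw [e2]; abel
        _ = k + l := by rw [hV, hV]; simp
    rw [this]
    exact add_mem hk hl
  have hle : 2 * #(A + H.elems) ≤ Fintype.card V := by
    have := card_le_univ ((A + H.elems) ∪ (c +ᵥ (A + H.elems)))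
    rw [card_union_of_disjoint hdisj, card_vadd_finset] at this
    omega
  -- both sides are multiples of `#H`, and they differ by less than `#H`
  have hcard : 2 * #(A + H.elems) = Fintype.card V := by
    have h₁ := hS.card_add hV
    have h₂ := card_le_card (subset_add_elems A H)
    obtain ⟨α, hα⟩ := (isPeriodic_add_elems A H).card_dvd
    have huniv : IsPeriodic H (univ : Finset V) := fun _ _ _ _ => mem_univ _
    obtain ⟨ν, hν⟩ := huniv.card_dvd
    rw [card_univ] at hν
    have h₃ : Fintype.card V < 2 * #(A + H.elems) + #H.elems := by omega
    rw [hα, hν, mul_left_comm, ← mul_add_one] at h₃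
    have := Nat.lt_of_mul_lt_mul_left h₃
    refine le_antisymm hle ?_
    rw [hα, hν, mul_left_comm]
    exact Nat.mul_le_mul_left _ (by omega)
  refine ⟨hcard, fun x => ⟨fun hx hx' => ?_, fun hx => ?_⟩⟩
  · exact disjoint_left.1 hdisj hx (mem_vadd_finset.2 ⟨x, hx', by rw [vadd_eq_add, add_comm]⟩)
  · have huniv : (A + H.elems) ∪ (c +ᵥ (A + H.elems)) = univ := by
      rw [← card_eq_iff_eq_univ, card_union_of_disjoint hdisj, card_vadd_finset]
      omega
    have := (mem_union.1 (huniv ▸ mem_univ x)).resolve_left hx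
    obtain ⟨y, hy, rfl⟩ := mem_vadd_finset.1 this
    rwa [vadd_eq_add, add_comm c, add_cancel_end hV]

/-- If `A₀ + A₁` misses a point outside the coset missed by `A₀ + A₀`, then `A₀` and `A₁` are sparse
in two cosets of `H`. -/
lemma card_add_card_add_le_of_notMem {A₀ A₁ : Finset V} {H : AddSubgroup V} {c z : V}
    (h0 : (0 : V) ∈ A₀) (hsub : A₁ ⊆ A₀) (hS : IsCosetCompl (A₀ + A₀) H c)
    (hlt : #(A₀ + A₀) < 2 * #A₀) (hH : 8 * #H.elems ≤ Fintype.card V)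
    (hz : z ∉ A₀ + A₁) (hzc : z + c ∉ H) : #A₀ + #A₁ + 2 * #H.elems ≤ Fintype.card V := by
  obtain ⟨hX, -⟩ := mem_add_elems_iff_of_isCosetCompl hV hS hlt
  -- a union `W` of two cosets of `H` that is invariant under translation by `z`
  obtain ⟨x, hx, y, hy, hxy, hW⟩ : ∃ x ∈ A₀, ∃ y ∈ A₀, x + y ∉ H ∧
      ∀ w, (x + w ∈ H ∨ y + w ∈ H) → (x + (z + w) ∈ H ∨ y + (z + w) ∈ H) := by
    by_cases hzH : z ∈ H
    · obtain ⟨y, hy, hyH⟩ : ∃ y ∈ A₀, y ∉ H := by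
        by_contra! h
        have : A₀ + H.elems ⊆ H.elems := by
          intro w hw
          obtain ⟨a, ha, k, hk, rfl⟩ := mem_add.1 hw
          rw [AddSubgroup.mem_elems] at hk ⊢
          exact add_mem (h a ha) hk
        have := card_le_card this
        have := H.card_elems_pos
        omega
      refine ⟨0, h0, y, hy, by simpa using hyH, fun w hw => ?_⟩
      rw [add_left_comm, add_left_comm y]
      exact hw.imp (add_mem hzH) (add_mem hzH)
    · have hzS : z ∈ A₀ + A₀ := by
        by_contra h
        exact hzc ((hS z).1 h)
      obtain ⟨x, hx, y, hy, rfl⟩ := mem_add.1 hzS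
      refine ⟨x, hx, y, hy, hzH, fun w hw => ?_⟩
      rw [add_assoc x y w, add_cancel_mid hV, add_left_comm y x, add_cancel_mid hV]
      exact hw.symm
  set W : Finset V := (x +ᵥ H.elems) ∪ (y +ᵥ H.elems) with hWdef
  have hmem : ∀ w, w ∈ W ↔ (x + w ∈ H ∨ y + w ∈ H) := by
    have aux : ∀ x w : V, w ∈ x +ᵥ H.elems ↔ x + w ∈ H := by
      intro x w
      rw [mem_vadd_finset]
      constructor
      · rintro ⟨k, hk, rfl⟩
        rw [vadd_eq_add, add_cancel_mid hV]
        exact AddSubgroup.mem_elems.1 hk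
      · intro h
        exact ⟨x + w, AddSubgroup.mem_elems.2 h, by rw [vadd_eq_add, add_cancel_mid hV]⟩
    intro w
    rw [hWdef, mem_union, aux, aux]
  have hWcard : #W = 2 * #H.elems := by
    rw [hWdef, card_union_of_disjoint, card_vadd_finset, card_vadd_finset, two_mul]
    rw [disjoint_left]
    intro w hw hw'
    obtain ⟨k, hk, rfl⟩ := mem_vadd_finset.1 hw
    obtain ⟨l, hl, e⟩ := mem_vadd_finset.1 hw'
    rw [AddSubgroup.mem_elems] at hk hl
    rw [vadd_eq_add, vadd_eq_add] at e
    apply hxy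
    have : x + y = l + k := by
      have e2 : y = x + k + l := by rw [← e, add_cancel_end hV]
      rw [e2, add_assoc x k l, add_cancel_mid hV, add_comm]
    rw [this]
    exact add_mem hl hk
  have hWX : W ⊆ A₀ + H.elems := by
    intro w hw
    rw [hWdef, mem_union] at hw
    rcases hw with hw | hw <;> obtain ⟨k, hk, rfl⟩ := mem_vadd_finset.1 hw
    · exact add_mem_add hx hk
    · exact add_mem_add hy hk
  have hdis : #(A₀ ∩ W) + #(A₁ ∩ W) ≤ #W := by
    rw [← card_vadd_finset z (A₁ ∩ W), ← card_union_of_disjoint]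
    · refine card_le_card (union_subset inter_subset_right fun w hw => ?_)
      obtain ⟨v, hv, rfl⟩ := mem_vadd_finset.1 hw
      exact (hmem _).2 (hW v ((hmem v).1 (mem_inter.1 hv).2))
    · rw [disjoint_left]
      intro w hw hw'
      obtain ⟨v, hv, rfl⟩ := mem_vadd_finset.1 hw'
      refine hz (mem_add.2 ⟨_, (mem_inter.1 hw).1, v, (mem_inter.1 hv).1, ?_⟩)
      rw [vadd_eq_add, add_cancel_end hV]
  have hout : ∀ A ⊆ A₀, #A + #W ≤ #(A ∩ W) + #(A₀ + H.elems) := by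
    intro A hA
    have h₁ := card_inter_add_card_sdiff A W
    have h₂ := card_sdiff_add_card_eq_card hWX
    have h₃ : #(A \ W) ≤ #((A₀ + H.elems) \ W) :=
      card_le_card (sdiff_subset_sdiff (hA.trans (subset_add_elems _ _)) Subset.rfl)
    omega
  have h₀ := hout A₀ Subset.rfl
  have h₁ := hout A₁ hsub
  omega

/-- If the lower section of the sumset of a nested pair misses a coset of large index, then the upper
section misses exactly the same coset. -/
lemma isCosetCompl_of_nested {A₀ A₁ : Finset V} {H : AddSubgroup V} {c : V}
    (h0 : (0 : V) ∈ A₁) (hsub : A₁ ⊆ A₀) (hS : IsCosetCompl (A₀ + A₀) H c)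
    (hlt : #(A₀ + A₀) < 2 * #A₀)
    (hlt' : #(A₀ + A₀) + #(A₀ + A₁) < 2 * #A₀ + 2 * #A₁)
    (hH : 8 * #H.elems ≤ Fintype.card V) : IsCosetCompl (A₀ + A₁) H c := by
  have hsub' : A₀ + A₁ ⊆ A₀ + A₀ := add_subset_add_left hsub
  intro z
  refine ⟨fun hz => ?_, fun hz h => (hS z).2 hz (hsub' h)⟩
  by_contra hzc
  have hsparse := card_add_card_add_le_of_notMem hV (hsub h0) hsub hS hlt hH hz hzc
  obtain ⟨hX, hXc⟩ := mem_add_elems_iff_of_isCosetCompl hV hS hlt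
  have hScard := hS.card_add hV
  have hA₀ := card_le_card (subset_add_elems A₀ H)
  obtain ⟨K, hK, hcard⟩ := kneser ⟨0, hsub h0⟩ ⟨0, h0⟩
  have hA₀K := card_le_card (subset_add_elems A₀ K)
  have hA₁K := card_le_card (subset_add_elems A₁ K)
  -- `A₀ + A₁` misses more than `3 * #H` points, whereas by Kneser's theorem it misses fewer than
  -- `#H + 2 * #K`
  have hHK : #H.elems < #K.elems := by omega
  obtain ⟨k, hkK, hkH⟩ : ∃ k ∈ K, k ∉ H := by
    by_contra! h
    have := card_le_card (AddSubgroup.elems_mono (H := K) (K := H) h)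
    omega
  set Q := H ⊔ K with hQ
  have hcQ : ∀ q ∈ Q, c + q ∉ A₀ + A₁ := by
    intro q hq hmem
    obtain ⟨h, hh, l, hl, rfl⟩ := AddSubgroup.mem_sup.1 hq
    have := hK _ hmem _ (neg_mem hl)
    rw [← add_assoc, add_neg_cancel_right] at this
    refine (hS (c + h)).2 ?_ (hsub' this)
    rwa [add_comm c, add_cancel_end hV]
  have hcQ' : c ∉ Q := fun h => hcQ c h (by
    rw [hV]; exact mem_add.2 ⟨0, hsub h0, 0, h0, add_zero 0⟩)
  -- `Z` is the complement of `A₀ + Q`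
  set Z := univ \ (A₀ + Q.elems) with hZ
  have hZcard : #Z + #(A₀ + Q.elems) = Fintype.card V := by
    rw [← card_univ]; exact card_sdiff_add_card_eq_card (subset_univ _)
  have hA₁Z : #A₁ ≤ #Z := by
    have : Disjoint A₁ (c +ᵥ (A₀ + Q.elems)) := by
      rw [disjoint_left]
      intro x hx hx'
      obtain ⟨y, hy, rfl⟩ := mem_vadd_finset.1 hx'
      obtain ⟨a, ha, q, hq, rfl⟩ := mem_add.1 hy
      refine hcQ q (AddSubgroup.mem_elems.1 hq) (mem_add.2 ⟨a, ha, _, hx, ?_⟩)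
      rw [vadd_eq_add, add_left_comm c, add_cancel_mid hV]
    have := card_union_of_disjoint this
    have := card_le_univ (A₁ ∪ (c +ᵥ (A₀ + Q.elems)))
    rw [card_vadd_finset] at *
    omega
  have hHQ : H.elems ⊆ Q.elems := AddSubgroup.elems_mono le_sup_left
  have hZQ : 2 * #Z + 2 * #Q.elems ≤ Fintype.card V := by
    -- `c + k` is a sum `a + b`, so `b + Q` and its translate by `c` lie in `A₀ + Q`
    have hck : c + k ∈ A₀ + A₀ := by
      by_contra h
      have := (hS _).1 h
      rw [add_comm c, add_cancel_end hV] at this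
      exact hkH this
    obtain ⟨a, ha, b, hb, hab⟩ := mem_add.1 hck
    have hbc : b + c = a + k := by
      calc b + c = a + (a + b) + c := by rw [add_cancel_mid hV]
        _ = a + k + (c + c) := by rw [hab]; abel
        _ = a + k := by rw [hV, add_zero]
    have hbQ : b +ᵥ Q.elems ⊆ A₀ + Q.elems := by
      intro x hx
      obtain ⟨q, hq, rfl⟩ := mem_vadd_finset.1 hx
      exact add_mem_add hb hq
    have hbcQ : (b + c) +ᵥ Q.elems ⊆ A₀ + Q.elems := by
      intro x hx
      obtain ⟨q, hq, rfl⟩ := mem_vadd_finset.1 hx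
      rw [hbc, vadd_eq_add, add_assoc]
      refine add_mem_add ha (AddSubgroup.mem_elems.2 ?_)
      exact add_mem (AddSubgroup.mem_sup_right hkK) (AddSubgroup.mem_elems.1 hq)
    have hd₁ : Disjoint (b +ᵥ Q.elems) ((b + c) +ᵥ Q.elems) := by
      rw [disjoint_left]
      intro x hx hx'
      obtain ⟨q, hq, rfl⟩ := mem_vadd_finset.1 hx
      obtain ⟨r, hr, e⟩ := mem_vadd_finset.1 hx'
      rw [AddSubgroup.mem_elems] at hq hr
      rw [vadd_eq_add, vadd_eq_add, add_assoc, add_right_inj] at e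
      apply hcQ'
      rw [eq_sub_of_add_eq e]
      exact sub_mem hq hr
    have hd₂ : Disjoint Z (c +ᵥ Z) := by
      rw [disjoint_left]
      intro x hx hx'
      obtain ⟨y, hy, rfl⟩ := mem_vadd_finset.1 hx'
      have hyX : y ∉ A₀ + H.elems := fun h =>
        (mem_sdiff.1 hy).2 (add_subset_add_left hHQ h)
      rw [← hXc, add_comm y] at hyX
      exact (mem_sdiff.1 hx).2 (add_subset_add_left hHQ hyX)
    have hd₃ : Disjoint (Z ∪ (c +ᵥ Z)) ((b +ᵥ Q.elems) ∪ ((b + c) +ᵥ Q.elems)) := by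
      rw [disjoint_left]
      intro x hx hx'
      rcases mem_union.1 hx with hx | hx
      · exact (mem_sdiff.1 hx).2 (union_subset hbQ hbcQ hx')
      · obtain ⟨y, hy, rfl⟩ := mem_vadd_finset.1 hx
        refine (mem_sdiff.1 hy).2 ?_
        rw [vadd_eq_add] at hx'
        rcases mem_union.1 hx' with h | h <;> obtain ⟨q, hq, e⟩ := mem_vadd_finset.1 h
        · refine hbcQ (mem_vadd_finset.2 ⟨q, hq, ?_⟩)
          rw [vadd_eq_add] at e ⊢
          rw [add_right_comm, e, add_comm c, add_cancel_end hV]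
        · refine hbQ (mem_vadd_finset.2 ⟨q, hq, ?_⟩)
          rw [vadd_eq_add] at e ⊢
          rw [add_comm b c, add_assoc, add_right_inj] at e
          exact e
    have := card_le_univ ((Z ∪ (c +ᵥ Z)) ∪ ((b +ᵥ Q.elems) ∪ ((b + c) +ᵥ Q.elems)))
    rw [card_union_of_disjoint hd₃, card_union_of_disjoint hd₂, card_union_of_disjoint hd₁] at this
    simp only [card_vadd_finset] at this
    omega
  -- so `A₁` falls short of half of the group by at least `#Q`; by Kneser's theorem this is too much,
  -- whether `Q = K` or `Q` is at least twice as large as both `H` and `K`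
  by_cases hle : H ≤ K
  · have hQK : Q = K := sup_eq_right.2 hle
    rw [hQK] at hZcard hZQ
    omega
  · have double : ∀ L : AddSubgroup V, L ≤ Q → (∃ q ∈ Q, q ∉ L) → 2 * #L.elems ≤ #Q.elems := by
      rintro L hL ⟨q, hq, hqL⟩
      have hdvd : #L.elems ∣ #Q.elems := by
        rw [AddSubgroup.card_elems, AddSubgroup.card_elems]
        exact AddSubgroup.card_dvd_of_le hL
      have hlt : #L.elems < #Q.elems := card_lt_card ⟨AddSubgroup.elems_mono hL, fun h =>
        hqL (AddSubgroup.mem_elems.1 (h (AddSubgroup.mem_elems.2 hq)))⟩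
      obtain ⟨m, hm⟩ := hdvd
      have : 1 < m := by
        by_contra! h
        have := Nat.mul_le_mul_left #L.elems h
        omega
      rw [hm, mul_comm]
      exact Nat.mul_le_mul_left _ this
    have h₁ := double H le_sup_left ⟨k, AddSubgroup.mem_sup_right hkK, hkH⟩
    obtain ⟨h, hh, hhK⟩ := SetLike.not_le_iff_exists.1 hle
    have h₂ := double K le_sup_right ⟨h, AddSubgroup.mem_sup_left hh, hhK⟩
    omega

/-- Adjoining an element to a subgroup of a group of exponent two doubles it. -/
lemma exists_double_subgroup (H : AddSubgroup V) {a : V} (ha : a ∉ H) :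
    ∃ H' : AddSubgroup V, (∀ x, x ∈ H' ↔ x ∈ H ∨ x + a ∈ H) ∧ #H'.elems = 2 * #H.elems := by
  let H' : AddSubgroup V :=
    { carrier := {x | x ∈ H ∨ x + a ∈ H}
      zero_mem' := Or.inl H.zero_mem
      add_mem' := by
        rintro x y (hx | hx) (hy | hy)
        · exact Or.inl (add_mem hx hy)
        · exact Or.inr (by rw [add_assoc]; exact add_mem hx hy)
        · exact Or.inr (by rw [add_right_comm]; exact add_mem hx hy)
        · left
          have := add_mem hx hy
          rwa [add_add_add_comm, hV, add_zero] at this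
      neg_mem' := by
        intro x hx
        rwa [← eq_neg_of_add_eq_zero_left (hV x)] }
  refine ⟨H', fun x => Iff.rfl, ?_⟩
  have : H'.elems = H.elems ∪ (a +ᵥ H.elems) := by
    ext x
    rw [mem_union, mem_vadd_finset, AddSubgroup.mem_elems, AddSubgroup.mem_elems]
    refine or_congr Iff.rfl ⟨fun hx => ⟨x + a, AddSubgroup.mem_elems.2 hx, ?_⟩, ?_⟩
    · rw [vadd_eq_add, add_comm, add_cancel_end hV]
    · rintro ⟨y, hy, rfl⟩
      rw [vadd_eq_add, add_comm a, add_cancel_end hV]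
      exact AddSubgroup.mem_elems.1 hy
  rw [this, card_union_of_disjoint, card_vadd_finset, two_mul]
  rw [disjoint_left]
  intro x hx hx'
  obtain ⟨y, hy, rfl⟩ := mem_vadd_finset.1 hx'
  rw [AddSubgroup.mem_elems] at hx hy
  exact ha (by simpa using sub_mem hx hy)

/-- The coset missed by the sumset of a generating set containing zero has index at least eight.
As `c` is not a sum of at most two elements of `A`, it is outside the subgroup generated by `H` and any
two elements of `A`, which leaves room for a third independent one. -/
lemma eight_mul_card_le_of_isCosetCompl {A : Finset V} (h0 : (0 : V) ∈ A)
    (hA : AddSubgroup.closure (A : Set V) = ⊤) {H : AddSubgroup V} {c : V}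
    (hS : IsCosetCompl (A + A) H c) : 8 * #H.elems ≤ Fintype.card V := by
  have hout : ∀ L : AddSubgroup V, c ∉ L → ∃ a ∈ A, a ∉ L := by
    intro L hc
    by_contra! h
    have : AddSubgroup.closure (A : Set V) ≤ L := (AddSubgroup.closure_le L).2 h
    rw [hA] at this
    exact hc (this (AddSubgroup.mem_top c))
  have hmiss : ∀ a ∈ A, ∀ b ∈ A, a + b + c ∉ H := fun a ha b hb h =>
    (hS _).2 h (add_mem_add ha hb)
  have hc₀ : c ∉ H := by simpa using hmiss 0 h0 0 h0
  obtain ⟨a, ha, haH⟩ := hout H hc₀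
  obtain ⟨H₁, hH₁, hcard₁⟩ := exists_double_subgroup hV H haH
  have hc₁ : c ∉ H₁ := by
    rw [hH₁]
    rintro (h | h)
    · exact hc₀ h
    · have := hmiss a ha 0 h0
      rw [add_zero, add_comm] at this
      exact this h
  obtain ⟨b, hb, hbH⟩ := hout H₁ hc₁
  obtain ⟨H₂, hH₂, hcard₂⟩ := exists_double_subgroup hV H₁ hbH
  have hc₂ : c ∉ H₂ := by
    rw [hH₂]
    rintro (h | h)
    · exact hc₁ h
    rw [hH₁] at h
    rcases h with h | h
    · have := hmiss b hb 0 h0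
      rw [add_zero, add_comm] at this
      exact this h
    · have := hmiss a ha b hb
      rw [add_comm, add_comm a b, ← add_assoc] at this
      exact this h
  obtain ⟨d, -, hdH⟩ := hout H₂ hc₂
  obtain ⟨H₃, -, hcard₃⟩ := exists_double_subgroup hV H₂ hdH
  have := card_le_univ H₃.elems
  omega

end ElementaryTwoGroup

/-! ### Subsets of the cube -/

section Cube

variable {n : ℕ}

/-- A subset of `𝔽₂ⁿ` closed under replacing a coordinate by zero. -/
def IsDownSet (A : Finset (Fin n → ZMod 2)) : Prop :=
  ∀ x ∈ A, ∀ i, x i ≠ 0 → x + Pi.single i 1 ∈ A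

/-- The set contains zero and the standard basis, hence generates `𝔽₂ⁿ`. -/
def ContainsBasis (A : Finset (Fin n → ZMod 2)) : Prop :=
  0 ∈ A ∧ ∀ i, Pi.single i 1 ∈ A

lemma cube_add_self (x : Fin n → ZMod 2) : x + x = 0 := by
  ext i
  exact CharTwo.add_self_eq_zero _

lemma zmod_two_eq_one {b : ZMod 2} (h : b ≠ 0) : b = 1 := by
  revert b; decide

lemma card_cube : Fintype.card (Fin n → ZMod 2) = 2 ^ n := by simp

lemma ContainsBasis.closure_eq_top {A : Finset (Fin n → ZMod 2)} (h : ContainsBasis A) :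
    AddSubgroup.closure (A : Set (Fin n → ZMod 2)) = ⊤ := by
  rw [eq_top_iff]
  intro x _
  rw [← Finset.univ_sum_single x]
  refine sum_mem fun i _ => ?_
  by_cases hi : x i = 0
  · rw [hi, Pi.single_zero]; exact zero_mem _
  · rw [zmod_two_eq_one hi]; exact AddSubgroup.subset_closure (h.2 i)

/-! ### Sections of subsets of the cube -/

/-- The section of `A ⊆ 𝔽₂ⁿ⁺¹` over the value `b` of the coordinate `0`. -/
def cubeSection (b : ZMod 2) (A : Finset (Fin (n + 1) → ZMod 2)) : Finset (Fin n → ZMod 2) :=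
  univ.filter fun x => (Fin.cons b x : Fin (n + 1) → ZMod 2) ∈ A

lemma mem_cubeSection {b : ZMod 2} {A : Finset (Fin (n + 1) → ZMod 2)} {x : Fin n → ZMod 2} :
    x ∈ cubeSection b A ↔ (Fin.cons b x : Fin (n + 1) → ZMod 2) ∈ A := by
  simp [cubeSection]

lemma cons_add_cons (a b : ZMod 2) (x y : Fin n → ZMod 2) :
    (Fin.cons a x + Fin.cons b y : Fin (n + 1) → ZMod 2) = Fin.cons (a + b) (x + y) := by
  ext i
  refine Fin.cases ?_ (fun j => ?_) i <;> simp

lemma single_zero_eq_cons : (Pi.single 0 1 : Fin (n + 1) → ZMod 2) = Fin.cons 1 0 := by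
  ext i
  refine Fin.cases ?_ (fun j => ?_) i <;> simp

lemma single_succ_eq_cons (i : Fin n) :
    (Pi.single i.succ 1 : Fin (n + 1) → ZMod 2) = Fin.cons 0 (Pi.single i 1) := by
  ext j
  refine Fin.cases ?_ (fun j => ?_) j
  · simp
  · simp [Pi.single_apply]

lemma cons_zero_zero : (Fin.cons 0 0 : Fin (n + 1) → ZMod 2) = 0 := by
  ext i
  refine Fin.cases ?_ (fun j => ?_) i <;> simp

lemma card_cubeSection (A : Finset (Fin (n + 1) → ZMod 2)) :
    #(cubeSection 0 A) + #(cubeSection 1 A) = #A := by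
  have inj : ∀ b : ZMod 2, Function.Injective
      (fun x : Fin n → ZMod 2 => (Fin.cons b x : Fin (n + 1) → ZMod 2)) :=
    fun b x y h => (Fin.cons_injective2 h).2
  rw [← card_image_of_injective _ (inj 0), ← card_image_of_injective _ (inj 1),
    ← card_union_of_disjoint]
  · congr 1
    ext x
    rw [mem_union, mem_image, mem_image]
    constructor
    · rintro (⟨y, hy, rfl⟩ | ⟨y, hy, rfl⟩) <;> exact mem_cubeSection.1 hy
    · intro hx
      by_cases h : x 0 = 0
      · exact Or.inl ⟨Fin.tail x, mem_cubeSection.2 (by rwa [← h, Fin.cons_self_tail]),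
          by rw [← h, Fin.cons_self_tail]⟩
      · have h := zmod_two_eq_one h
        exact Or.inr ⟨Fin.tail x, mem_cubeSection.2 (by rwa [← h, Fin.cons_self_tail]),
          by rw [← h, Fin.cons_self_tail]⟩
  · rw [disjoint_left]
    intro x hx hx'
    obtain ⟨y, -, rfl⟩ := mem_image.1 hx
    obtain ⟨z, -, e⟩ := mem_image.1 hx'
    have := congrFun e 0
    simp at this

lemma IsDownSet.cubeSection_one_subset {A : Finset (Fin (n + 1) → ZMod 2)} (h : IsDownSet A) :
    cubeSection 1 A ⊆ cubeSection 0 A := by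
  intro x hx
  rw [mem_cubeSection] at hx ⊢
  have := h _ hx 0 (by simp)
  rwa [single_zero_eq_cons, cons_add_cons, add_zero, CharTwo.add_self_eq_zero] at this

lemma IsDownSet.cubeSection_zero {A : Finset (Fin (n + 1) → ZMod 2)} (h : IsDownSet A) :
    IsDownSet (cubeSection 0 A) := by
  intro x hx i hi
  rw [mem_cubeSection] at hx ⊢
  have := h _ hx i.succ (by simpa using hi)
  rwa [single_succ_eq_cons, cons_add_cons, add_zero] at this

lemma ContainsBasis.cubeSection_zero {A : Finset (Fin (n + 1) → ZMod 2)} (h : ContainsBasis A) :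
    ContainsBasis (cubeSection 0 A) := by
  refine ⟨mem_cubeSection.2 ?_, fun i => mem_cubeSection.2 ?_⟩
  · rw [cons_zero_zero]; exact h.1
  · rw [← single_succ_eq_cons]; exact h.2 _

lemma ContainsBasis.zero_mem_cubeSection_one {A : Finset (Fin (n + 1) → ZMod 2)}
    (h : ContainsBasis A) : 0 ∈ cubeSection 1 A := by
  rw [mem_cubeSection, ← single_zero_eq_cons]
  exact h.2 0

lemma cubeSection_zero_add_self {A : Finset (Fin (n + 1) → ZMod 2)} (h : IsDownSet A) :
    cubeSection 0 (A + A) = cubeSection 0 A + cubeSection 0 A := by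
  ext z
  rw [mem_cubeSection, mem_add, mem_add]
  constructor
  · rintro ⟨x, hx, y, hy, e⟩
    rw [← Fin.cons_self_tail x] at hx e
    rw [← Fin.cons_self_tail y] at hy e
    rw [cons_add_cons] at e
    obtain ⟨e₁, e₂⟩ := Fin.cons_injective2 e
    have hmem : ∀ (b : ZMod 2) (w : Fin n → ZMod 2),
        (Fin.cons b w : Fin (n + 1) → ZMod 2) ∈ A → w ∈ cubeSection 0 A := by
      intro b w hw
      by_cases hb : b = 0
      · exact mem_cubeSection.2 (hb ▸ hw)
      · exact h.cubeSection_one_subset (mem_cubeSection.2 (zmod_two_eq_one hb ▸ hw))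
    exact ⟨_, hmem _ _ hx, _, hmem _ _ hy, e₂⟩
  · rintro ⟨x, hx, y, hy, rfl⟩
    exact ⟨_, mem_cubeSection.1 hx, _, mem_cubeSection.1 hy, by rw [cons_add_cons, add_zero]⟩

lemma cubeSection_one_add_self (A : Finset (Fin (n + 1) → ZMod 2)) :
    cubeSection 1 (A + A) = cubeSection 0 A + cubeSection 1 A := by
  ext z
  rw [mem_cubeSection, mem_add, mem_add]
  constructor
  · rintro ⟨x, hx, y, hy, e⟩
    rw [← Fin.cons_self_tail x] at hx e
    rw [← Fin.cons_self_tail y] at hy e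
    rw [cons_add_cons] at e
    obtain ⟨e₁, e₂⟩ := Fin.cons_injective2 e
    by_cases hb : x 0 = 0
    · rw [hb, zero_add] at e₁
      rw [hb] at hx
      rw [e₁] at hy
      exact ⟨_, mem_cubeSection.2 hx, _, mem_cubeSection.2 hy, e₂⟩
    · have hb := zmod_two_eq_one hb
      rw [hb] at e₁ hx
      have : y 0 = 0 := by simpa using e₁
      rw [this] at hy
      exact ⟨_, mem_cubeSection.2 hy, _, mem_cubeSection.2 hx, by rw [add_comm, e₂]⟩
  · rintro ⟨x, hx, y, hy, rfl⟩
    exact ⟨_, mem_cubeSection.1 hx, _, mem_cubeSection.1 hy, by rw [cons_add_cons, zero_add]⟩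

/-! ### Sumsets of generating down-sets -/

/-- The projection of `𝔽₂ⁿ⁺¹` forgetting the coordinate `0`. -/
def tailHom (n : ℕ) : (Fin (n + 1) → ZMod 2) →+ (Fin n → ZMod 2) where
  toFun := Fin.tail
  map_zero' := rfl
  map_add' _ _ := rfl

/-- The sumset of a generating down-set of doubling less than two misses at most one coset of a
subgroup. -/
theorem IsDownSet.add_self_eq_univ_or_isCosetCompl :
    ∀ {n : ℕ} {A : Finset (Fin n → ZMod 2)}, IsDownSet A → ContainsBasis A →
      #(A + A) < 2 * #A → A + A = univ ∨ ∃ H c, IsCosetCompl (A + A) H c := by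
  intro n
  induction n with
  | zero =>
    intro A _ hb _
    left
    rw [eq_univ_iff_forall]
    intro x
    exact mem_add.2 ⟨0, hb.1, 0, hb.1, Subsingleton.elim _ _⟩
  | succ n ih =>
    intro A hd hb hlt
    have hsub := hd.cubeSection_one_subset
    have h1 := hb.zero_mem_cubeSection_one
    have hb₀ := hb.cubeSection_zero
    rw [← card_cubeSection A, ← card_cubeSection (A + A), cubeSection_zero_add_self hd,
      cubeSection_one_add_self, mul_add] at hlt
    have hlt₀ := card_add_self_lt_of_nested ⟨0, h1⟩ hsub hlt
    have hmem₀ : ∀ x : Fin (n + 1) → ZMod 2, x 0 = 0 →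
        (x ∈ A + A ↔ Fin.tail x ∈ cubeSection 0 A + cubeSection 0 A) := by
      intro x hx
      rw [← cubeSection_zero_add_self hd, mem_cubeSection, ← hx, Fin.cons_self_tail]
    have hmem₁ : ∀ x : Fin (n + 1) → ZMod 2, x 0 = 1 →
        (x ∈ A + A ↔ Fin.tail x ∈ cubeSection 0 A + cubeSection 1 A) := by
      intro x hx
      rw [← cubeSection_one_add_self, mem_cubeSection, ← hx, Fin.cons_self_tail]
    rcases ih hd.cubeSection_zero hb₀ hlt₀ with hu | ⟨H, c, hS⟩
    · -- the missing points all have first coordinate one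
      rw [hu, card_univ] at hlt
      rcases exists_isCosetCompl_of_card_lt cube_add_self ⟨0, hb₀.1⟩ ⟨0, h1⟩ hlt with
        hu' | ⟨K, c, hS⟩
      · left
        rw [eq_univ_iff_forall]
        intro x
        by_cases hx : x 0 = 0
        · rw [hmem₀ x hx, hu]; exact mem_univ _
        · rw [hmem₁ x (zmod_two_eq_one hx), hu']; exact mem_univ _
      · refine Or.inr ⟨K.comap (tailHom n) ⊓ (Pi.evalAddMonoidHom (fun _ => ZMod 2) 0).ker,
          Fin.cons 1 c, fun x => ?_⟩
        rw [AddSubgroup.mem_inf, AddSubgroup.mem_comap, AddMonoidHom.mem_ker]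
        have e₁ : tailHom n (x + Fin.cons 1 c) = Fin.tail x + c := rfl
        have e₂ : Pi.evalAddMonoidHom (fun _ => ZMod 2) 0 (x + (Fin.cons 1 c : Fin (n + 1) → _))
          = x 0 + 1 := rfl
        rw [e₁, e₂]
        by_cases hx : x 0 = 0
        · rw [hmem₀ x hx, hu, hx]; simp
        · rw [hmem₁ x (zmod_two_eq_one hx), hS, zmod_two_eq_one hx]
          simp [CharTwo.add_self_eq_zero]
    · -- both sections miss the same coset
      have hH := eight_mul_card_le_of_isCosetCompl cube_add_self hb₀.1 hb₀.closure_eq_top hS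
      have hS' := isCosetCompl_of_nested cube_add_self h1 hsub hS hlt₀ hlt hH
      refine Or.inr ⟨H.comap (tailHom n), Fin.cons 0 c, fun x => ?_⟩
      rw [AddSubgroup.mem_comap]
      have e₁ : tailHom n (x + Fin.cons 0 c) = Fin.tail x + c := rfl
      rw [e₁]
      by_cases hx : x 0 = 0
      · rw [hmem₀ x hx, hS]
      · rw [hmem₁ x (zmod_two_eq_one hx), hS']

/-! ### Compression -/

/-- The injection of `A` into the cube which moves a point with nonzero coordinate `i` to the
hyperplane `x i = 0` whenever the target is not already in `A`. -/
def compressFun (i : Fin n) (A : Finset (Fin n → ZMod 2)) (x : Fin n → ZMod 2) : Fin n → ZMod 2 :=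
  if x + Pi.single i 1 ∈ A ∨ x i = 0 then x else x + Pi.single i 1

/-- The compression of `A` in the direction of the coordinate `i`. -/
def cubeCompress (i : Fin n) (A : Finset (Fin n → ZMod 2)) : Finset (Fin n → ZMod 2) :=
  A.image (compressFun i A)

lemma add_single_apply_self (i : Fin n) (x : Fin n → ZMod 2) :
    (x + Pi.single i 1 : Fin n → ZMod 2) i = 0 ↔ x i ≠ 0 := by
  rw [Pi.add_apply, Pi.single_eq_same]
  generalize x i = b
  revert b
  decide

lemma mem_cubeCompress {i : Fin n} {A : Finset (Fin n → ZMod 2)} {y : Fin n → ZMod 2} :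
    y ∈ cubeCompress i A ↔ (y ∈ A ∧ y + Pi.single i 1 ∈ A) ∨
      (y i = 0 ∧ (y ∈ A ∨ y + Pi.single i 1 ∈ A)) := by
  rw [cubeCompress, mem_image]
  constructor
  · rintro ⟨x, hx, rfl⟩
    unfold compressFun
    split_ifs with h
    · rcases h with h | h
      · exact Or.inl ⟨hx, h⟩
      · exact Or.inr ⟨h, Or.inl hx⟩
    · push Not at h
      exact Or.inr ⟨(add_single_apply_self i x).2 h.2,
        Or.inr (by rwa [add_cancel_end cube_add_self])⟩
  · intro h
    by_cases hy : y ∈ A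
    · refine ⟨y, hy, ?_⟩
      rw [compressFun, if_pos]
      tauto
    · have h' : y i = 0 ∧ y + Pi.single i 1 ∈ A := by tauto
      refine ⟨_, h'.2, ?_⟩
      rw [compressFun, add_cancel_end cube_add_self, if_neg]
      rw [add_single_apply_self]
      tauto

lemma compressFun_injOn (i : Fin n) (A : Finset (Fin n → ZMod 2)) :
    Set.InjOn (compressFun i A) A := by
  intro x hx y hy h
  rw [mem_coe] at hx hy
  unfold compressFun at h
  split_ifs at h with h₁ h₂ h₂
  · exact h
  · rw [h, add_cancel_end cube_add_self] at h₁
    rw [← h] at h₂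
    exact absurd (Or.inl hx) h₂
  · rw [h] at h₁
    exact absurd (Or.inl hy) h₁
  · exact add_right_cancel h

lemma card_cubeCompress (i : Fin n) (A : Finset (Fin n → ZMod 2)) :
    #(cubeCompress i A) = #A :=
  card_image_of_injOn (compressFun_injOn i A)

lemma cubeCompress_add_subset (i : Fin n) (A : Finset (Fin n → ZMod 2)) :
    cubeCompress i A + cubeCompress i A ⊆ cubeCompress i (A + A) := by
  intro z hz
  obtain ⟨x, hx, y, hy, rfl⟩ := mem_add.1 hz
  rw [mem_cubeCompress] at hx hy ⊢
  have e₁ : ∀ e : Fin n → ZMod 2, x + y + e = x + (y + e) := fun e => add_assoc _ _ _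
  have e₂ : ∀ e : Fin n → ZMod 2, x + y + e = (x + e) + y := fun e => add_right_comm _ _ _
  have e₃ : ∀ e : Fin n → ZMod 2, x + y = (x + e) + (y + e) := fun e => by
    rw [add_add_add_comm, cube_add_self, add_zero]
  rcases hx with ⟨hx, hx'⟩ | ⟨hx0, hx⟩
  · left
    rcases hy with ⟨hy, hy'⟩ | ⟨-, hy | hy⟩
    · exact ⟨add_mem_add hx hy, e₁ _ ▸ add_mem_add hx hy'⟩
    · exact ⟨add_mem_add hx hy, e₂ _ ▸ add_mem_add hx' hy⟩
    · exact ⟨e₃ (Pi.single i 1) ▸ add_mem_add hx' hy, e₁ _ ▸ add_mem_add hx hy⟩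
  · rcases hy with ⟨hy, hy'⟩ | ⟨hy0, hy⟩
    · left
      rcases hx with hx | hx
      · exact ⟨add_mem_add hx hy, e₁ _ ▸ add_mem_add hx hy'⟩
      · exact ⟨e₃ (Pi.single i 1) ▸ add_mem_add hx hy', e₂ _ ▸ add_mem_add hx hy⟩
    · right
      refine ⟨by rw [Pi.add_apply, hx0, hy0, add_zero], ?_⟩
      rcases hx with hx | hx <;> rcases hy with hy | hy
      · exact Or.inl (add_mem_add hx hy)
      · exact Or.inr (e₁ _ ▸ add_mem_add hx hy)
      · exact Or.inr (e₂ _ ▸ add_mem_add hx hy)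
      · exact Or.inl (e₃ (Pi.single i 1) ▸ add_mem_add hx hy)

lemma card_cubeCompress_add_le (i : Fin n) (A : Finset (Fin n → ZMod 2)) :
    #(cubeCompress i A + cubeCompress i A) ≤ #(A + A) :=
  (card_le_card (cubeCompress_add_subset i A)).trans (card_cubeCompress i _).le

lemma ContainsBasis.cubeCompress {A : Finset (Fin n → ZMod 2)} (h : ContainsBasis A) (i : Fin n) :
    ContainsBasis (cubeCompress i A) := by
  refine ⟨mem_cubeCompress.2 (Or.inr ⟨rfl, Or.inl h.1⟩), fun j => mem_cubeCompress.2 ?_⟩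
  by_cases hij : i = j
  · subst hij
    exact Or.inl ⟨h.2 i, by rw [cube_add_self]; exact h.1⟩
  · exact Or.inr ⟨Pi.single_eq_of_ne hij _, Or.inl (h.2 j)⟩

/-- The total number of nonzero coordinates of the points of `A`. -/
def cubeWeight (A : Finset (Fin n → ZMod 2)) : ℕ := ∑ x ∈ A, #(univ.filter fun i => x i ≠ 0)

lemma cubeWeight_cubeCompress_lt {A : Finset (Fin n → ZMod 2)} {x : Fin n → ZMod 2} {i : Fin n}
    (hx : x ∈ A) (hi : x i ≠ 0) (hxA : x + Pi.single i 1 ∉ A) :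
    cubeWeight (cubeCompress i A) < cubeWeight A := by
  rw [cubeWeight, cubeCompress, sum_image (compressFun_injOn i A), cubeWeight]
  have key : ∀ y : Fin n → ZMod 2, y i ≠ 0 →
      #(univ.filter fun j => (y + Pi.single i 1 : Fin n → ZMod 2) j ≠ 0) < #(univ.filter fun j => y j ≠ 0) := by
    intro y hy
    refine card_lt_card ⟨fun j hj => ?_, fun h => ?_⟩
    · rw [mem_filter] at hj ⊢
      refine ⟨mem_univ _, ?_⟩
      by_cases hij : j = i
      · rwa [hij]
      · simpa [Pi.single_eq_of_ne hij] using hj.2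
    · have := h (mem_filter.2 ⟨mem_univ i, hy⟩)
      exact (mem_filter.1 this).2 ((add_single_apply_self i y).2 hy)
  refine sum_lt_sum (fun y _ => ?_) ⟨x, hx, ?_⟩
  · unfold compressFun
    split_ifs with h
    · exact le_rfl
    · push Not at h
      exact (key y h.2).le
  · rw [compressFun, if_neg (by tauto)]
    exact key x hi

/-- Compressing as long as the weight drops turns a generating set into a generating down-set. -/
lemma ContainsBasis.exists_isDownSet {A : Finset (Fin n → ZMod 2)} (h : ContainsBasis A) :
    ∃ B : Finset (Fin n → ZMod 2), IsDownSet B ∧ ContainsBasis B ∧ #B = #A ∧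
      #(B + B) ≤ #(A + A) := by
  induction hw : cubeWeight A using Nat.strong_induction_on generalizing A with
  | _ w ih =>
    by_cases hd : IsDownSet A
    · exact ⟨A, hd, h, rfl, le_rfl⟩
    · unfold IsDownSet at hd
      push Not at hd
      obtain ⟨x, hx, i, hi, hxA⟩ := hd
      obtain ⟨B, hB, hb, hcard, hadd⟩ :=
        ih _ (hw ▸ cubeWeight_cubeCompress_lt hx hi hxA) (h.cubeCompress i) rfl
      exact ⟨B, hB, hb, hcard.trans (card_cubeCompress i A),
        hadd.trans (card_cubeCompress_add_le i A)⟩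

/-- The sumset of a generating set of doubling less than two fills at least seven eighths of the
group. -/
theorem ContainsBasis.seven_mul_two_pow_le {A : Finset (Fin n → ZMod 2)} (h : ContainsBasis A)
    (hlt : #(A + A) < 2 * #A) : 7 * 2 ^ n ≤ 8 * #(A + A) := by
  obtain ⟨B, hB, hb, hcard, hadd⟩ := h.exists_isDownSet
  suffices 7 * 2 ^ n ≤ 8 * #(B + B) by omega
  rcases hB.add_self_eq_univ_or_isCosetCompl hb (by omega) with hu | ⟨H, c, hS⟩
  · rw [hu, card_univ, card_cube]; omega
  · have h₁ := hS.card_add cube_add_self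
    have h₂ := eight_mul_card_le_of_isCosetCompl cube_add_self hb.1 hb.closure_eq_top hS
    rw [card_cube] at h₁ h₂
    omega

end Cube

/-! ### The covering constant: upper bounds -/

/-- A set of doubling less than two lies in an affine subspace, of cardinality at most `N` say, such
that the sumset has at least `7/8 * N` elements. Moreover the sumset has all of `N` elements, or else the
set itself has at most `N / 2`. -/
theorem exists_affineSubspace_of_card_add_lt {m : ℕ} {A : Finset (Fin m → ZMod 2)}
    (hA : A.Nonempty) (hlt : #(A + A) < 2 * #A) :
    ∃ (V : AffineSubspace (ZMod 2) (Fin m → ZMod 2)) (N : ℕ),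
      (A : Set (Fin m → ZMod 2)) ⊆ (V : Set (Fin m → ZMod 2)) ∧ Nat.card V ≤ N ∧
        7 * N ≤ 8 * #(A + A) ∧ (N ≤ #(A + A) ∨ 2 * #A ≤ N) := by
  obtain ⟨a, ha⟩ := hA
  -- translate so that the set contains zero, and take a basis of its span inside it
  set A' : Finset (Fin m → ZMod 2) := a +ᵥ A with hA'
  have h0 : (0 : Fin m → ZMod 2) ∈ A' :=
    mem_vadd_finset.2 ⟨a, ha, by rw [vadd_eq_add, cube_add_self]⟩
  have hcard : #A' = #A := card_vadd_finset _ _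
  have hcard₂ : #(A' + A') = #(A + A) := by
    rw [hA', vadd_add_assoc, add_vadd_comm, card_vadd_finset, card_vadd_finset]
  obtain ⟨b, hbA, hspan, hlin⟩ :=
    exists_linearIndependent (ZMod 2) (A' : Set (Fin m → ZMod 2))
  have : Finite b := A'.finite_toSet.subset hbA
  let e := Finite.equivFin b
  set n := Nat.card b
  let v : Fin n → Fin m → ZMod 2 := fun i => (e.symm i : Fin m → ZMod 2)
  have hv : LinearIndependent (ZMod 2) v := hlin.comp e.symm e.symm.injective
  have hrange : Set.range v = b := by
    have : v = Subtype.val ∘ e.symm := rfl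
    rw [this, e.symm.surjective.range_comp, Subtype.range_val]
  set L := Fintype.linearCombination (ZMod 2) v with hL
  have hinj : Function.Injective L := hv.fintypeLinearCombination_injective
  have hLrange : LinearMap.range L = Submodule.span (ZMod 2) (A' : Set (Fin m → ZMod 2)) := by
    rw [hL, Fintype.range_linearCombination, hrange, hspan]
  -- the set in coordinates
  let B : Finset (Fin n → ZMod 2) := univ.filter fun x => L x ∈ A'
  have hBmem : ∀ x, x ∈ B ↔ L x ∈ A' := fun x => by simp [B]
  have hBimage : B.image L = A' := by
    ext y
    rw [mem_image]
    constructor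
    · rintro ⟨x, hx, rfl⟩
      exact (hBmem x).1 hx
    · intro hy
      have : y ∈ LinearMap.range L := by
        rw [hLrange]; exact Submodule.subset_span hy
      obtain ⟨x, rfl⟩ := this
      exact ⟨x, (hBmem x).2 hy, rfl⟩
  have hB : ContainsBasis B := by
    refine ⟨(hBmem _).2 (by rwa [map_zero]), fun i => (hBmem _).2 ?_⟩
    rw [hL, Fintype.linearCombination_apply_single, one_smul]
    exact hbA (e.symm i).2
  have hBcard : #B = #A := by
    rw [← hcard, ← hBimage, card_image_of_injective _ hinj]
  have hBcard₂ : #(B + B) = #(A + A) := by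
    rw [← hcard₂, ← hBimage, ← image_add, card_image_of_injective _ hinj]
  refine ⟨AffineSubspace.mk' a (LinearMap.range L), 2 ^ n, ?_, ?_, ?_, ?_⟩
  · intro x hx
    rw [SetLike.mem_coe, AffineSubspace.mem_mk', hLrange]
    refine Submodule.subset_span (mem_vadd_finset.2 ⟨x, hx, ?_⟩)
    rw [vadd_eq_add, vsub_eq_sub, eq_sub_iff_add_eq, add_comm a, add_cancel_end cube_add_self]
  · have hmem : ∀ x, L x + a ∈ AffineSubspace.mk' a (LinearMap.range L) := fun x => by
      rw [AffineSubspace.mem_mk', vsub_eq_sub, add_sub_cancel_right]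
      exact ⟨x, rfl⟩
    refine (Nat.card_le_card_of_surjective
      (fun x => (⟨L x + a, hmem x⟩ : AffineSubspace.mk' a (LinearMap.range L))) ?_).trans
      (by rw [Nat.card_eq_fintype_card, card_cube])
    rintro ⟨y, hy⟩
    rw [AffineSubspace.mem_mk', vsub_eq_sub] at hy
    obtain ⟨x, hx⟩ := hy
    exact ⟨x, Subtype.ext (by simp [hx])⟩
  · rw [← hBcard₂]
    exact hB.seven_mul_two_pow_le (by omega)
  · by_cases hu : ∀ z, z ∈ B + B
    · left
      rw [← hBcard₂, eq_univ_iff_forall.2 hu, card_univ, card_cube]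
    · right
      push Not at hu
      obtain ⟨z, hz⟩ := hu
      have := card_add_card_le_of_notMem_add cube_add_self hz
      rw [card_cube] at this
      omega

lemma card_add_le_of_addConst_le {m : ℕ} {A : Finset (Fin m → ZMod 2)} {K : ℝ}
    (hA : A.Nonempty) (h : (σ[A] : ℝ) ≤ K) : (#(A + A) : ℝ) ≤ K * #A := by
  rwa [Finset.cast_addConst, div_le_iff₀ (by exact_mod_cast hA.card_pos)] at h

lemma isCoveringConstant_eight_sevenths {K : ℝ} (h₁ : 1 ≤ K) (h₂ : K < 2) :
    IsCoveringConstant K (8 / 7 * K) := by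
  refine ⟨by linarith, fun m _ A hA hσ => ?_⟩
  have hle := card_add_le_of_addConst_le hA hσ
  have hpos : (0 : ℝ) < #A := by exact_mod_cast hA.card_pos
  have hlt : #(A + A) < 2 * #A := by
    have : (#(A + A) : ℝ) < 2 * #A := by nlinarith
    exact_mod_cast this
  obtain ⟨V, N, hAV, hVN, hN, -⟩ := exists_affineSubspace_of_card_add_lt hA hlt
  refine ⟨V, hAV, ?_⟩
  have hVN : (Nat.card V : ℝ) ≤ N := by exact_mod_cast hVN
  have hN : (7 * N : ℝ) ≤ 8 * #(A + A) := by exact_mod_cast hN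
  linarith

lemma isCoveringConstant_self {K : ℝ} (h₁ : 1 ≤ K) (h₂ : K < 7 / 4) :
    IsCoveringConstant K K := by
  refine ⟨by linarith, fun m _ A hA hσ => ?_⟩
  have hle := card_add_le_of_addConst_le hA hσ
  have hpos : (0 : ℝ) < #A := by exact_mod_cast hA.card_pos
  have hlt : (#(A + A) : ℝ) < 7 / 4 * #A := by nlinarith
  have hlt' : #(A + A) < 2 * #A := by
    have : (#(A + A) : ℝ) < 2 * #A := by linarith
    exact_mod_cast this
  obtain ⟨V, N, hAV, hVN, hN, hN' | hN'⟩ := exists_affineSubspace_of_card_add_lt hA hlt'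
  · refine ⟨V, hAV, ?_⟩
    have : (Nat.card V : ℝ) ≤ #(A + A) := by exact_mod_cast hVN.trans hN'
    linarith
  · -- density at most one half, with a sumset of density at least `7/8`, means doubling `≥ 7/4`
    exfalso
    have hN : (7 * N : ℝ) ≤ 8 * #(A + A) := by exact_mod_cast hN
    have hN' : (2 * #A : ℝ) ≤ N := by exact_mod_cast hN'
    linarith

/-! ### The covering constant: lower bounds -/

lemma ContainsBasis.mem_of_subset_affineSubspace {n : ℕ} {A : Finset (Fin n → ZMod 2)}
    (h : ContainsBasis A) {V : AffineSubspace (ZMod 2) (Fin n → ZMod 2)}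
    (hV : (A : Set (Fin n → ZMod 2)) ⊆ (V : Set (Fin n → ZMod 2))) (x : Fin n → ZMod 2) :
    x ∈ V := by
  have h0 : (0 : Fin n → ZMod 2) ∈ V := hV h.1
  have hle : AddSubgroup.closure (A : Set (Fin n → ZMod 2)) ≤ V.direction.toAddSubgroup := by
    rw [AddSubgroup.closure_le]
    intro a ha
    have := AffineSubspace.vsub_mem_direction (hV ha) h0
    rwa [vsub_eq_sub, sub_zero] at this
  rw [h.closure_eq_top] at hle
  have hx : x ∈ V.direction := hle (AddSubgroup.mem_top x)
  simpa using AffineSubspace.vadd_mem_of_mem_direction hx h0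

lemma exists_nat_lt_mul_two_pow {ε : ℝ} (hε : 0 < ε) : ∃ n : ℕ, 3 ≤ n ∧ (n : ℝ) < ε * 2 ^ n := by
  have h := tendsto_pow_const_div_const_pow_of_one_lt 1 (one_lt_two (α := ℝ))
  obtain ⟨n, hn, hn'⟩ := ((h.eventually_lt_const hε).and (Filter.eventually_ge_atTop 3)).exists
  refine ⟨n, hn', ?_⟩
  rwa [pow_one, div_lt_iff₀ (by positivity)] at hn

/-- A lower bound for covering constants from generating sets `P ⊆ 𝔽₂ⁿ` whose sumset has density at
most `s`: a subset of `P` that still generates, of cardinality just above `s * 2 ^ n / K`, has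
doubling at most `K` and is only covered by the whole space. -/
lemma IsCoveringConstant.le_mul {K C s : ℝ} (hK : 0 < K) (hs : 0 < s) (hC : IsCoveringConstant K C)
    (hP : ∀ n : ℕ, 3 ≤ n → ∃ P : Finset (Fin n → ZMod 2), ContainsBasis P ∧
      s * 2 ^ n ≤ K * #P ∧ (#(P + P) : ℝ) ≤ s * 2 ^ n) : K ≤ C * s := by
  obtain ⟨hCpos, hC⟩ := hC
  by_contra! hlt
  set r := s / K with hr
  have hrpos : 0 < r := by positivity
  have hCr : C * r < 1 := by
    rw [hr, ← mul_div_assoc, div_lt_one hK]; exact hlt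
  obtain ⟨n, hn3, hn⟩ := exists_nat_lt_mul_two_pow
    (show 0 < min (r / 2) ((1 - C * r) / C) from lt_min (by positivity) (div_pos (by linarith) hCpos))
  have h2n : (0 : ℝ) < 2 ^ n := by positivity
  have hn1 : (n : ℝ) < r / 2 * 2 ^ n :=
    hn.trans_le (mul_le_mul_of_nonneg_right (min_le_left _ _) h2n.le)
  have hn2 : C * n < (1 - C * r) * 2 ^ n := by
    have := hn.trans_le (mul_le_mul_of_nonneg_right (min_le_right _ _) h2n.le)
    rw [div_mul_eq_mul_div, lt_div_iff₀ hCpos] at this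
    linarith
  have hn3' : (3 : ℝ) ≤ n := by exact_mod_cast hn3
  obtain ⟨P, hbP, hPcard, hPP⟩ := hP n hn3
  set a := ⌈r * 2 ^ n⌉₊ with ha
  have ha₁ : r * 2 ^ n ≤ a := Nat.le_ceil _
  have ha₂ : (a : ℝ) < r * 2 ^ n + 1 := Nat.ceil_lt_add_one (by positivity)
  -- a generating subset of `P` of cardinality `a`
  let S : Finset (Fin n → ZMod 2) := insert 0 (univ.image fun i => Pi.single i 1)
  have hSP : S ⊆ P := by
    refine insert_subset hbP.1 fun x hx => ?_
    obtain ⟨i, -, rfl⟩ := mem_image.1 hx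
    exact hbP.2 i
  have hScard : #S ≤ a := by
    have h₁ : #S ≤ n + 1 := (card_insert_le _ _).trans
      (Nat.add_le_add_right (card_image_le.trans (by simp)) 1)
    have h₂ : ((n + 1 : ℕ) : ℝ) ≤ a := by push_cast; linarith
    exact h₁.trans (by exact_mod_cast h₂)
  have haP : a ≤ #P := by
    refine Nat.ceil_le.2 ?_
    rw [hr, div_mul_eq_mul_div, div_le_iff₀ hK]
    linarith
  obtain ⟨A, hSA, hAP, hAcard⟩ := exists_subsuperset_card_eq hSP hScard haP
  have hbA : ContainsBasis A := ⟨hSA (mem_insert_self _ _), fun i =>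
    hSA (mem_insert_of_mem (mem_image_of_mem _ (mem_univ i)))⟩
  have hapos : (0 : ℝ) < a := lt_of_lt_of_le (by positivity) ha₁
  have hσ : (σ[A] : ℝ) ≤ K := by
    rw [Finset.cast_addConst, hAcard, div_le_iff₀ hapos]
    have h₁ : (#(A + A) : ℝ) ≤ #(P + P) := by
      exact_mod_cast card_le_card (add_subset_add hAP hAP)
    have h₂ : K * (r * 2 ^ n) = s * 2 ^ n := by rw [hr]; field_simp
    nlinarith
  obtain ⟨V, hAV, hVcard⟩ := hC n (by omega) A ⟨0, hbA.1⟩ hσ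
  have hV : 2 ^ n ≤ Nat.card V := by
    rw [← card_cube, ← Nat.card_eq_fintype_card]
    exact Nat.card_le_card_of_injective
      (fun x => (⟨x, hbA.mem_of_subset_affineSubspace hAV x⟩ : V))
      fun x y h => congrArg Subtype.val h
  have hV : (2 ^ n : ℝ) ≤ Nat.card V := by exact_mod_cast hV
  rw [hAcard] at hVcard
  nlinarith

/-- The points of `𝔽₂ᵐ⁺³` with at most one nonzero coordinate among the first three generate, have
density one half, and their sumset misses the points whose first three coordinates are all one. -/
lemma exists_containsBasis_card_add_le (m : ℕ) : ∃ P : Finset (Fin (m + 3) → ZMod 2),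
    ContainsBasis P ∧ 2 ^ (m + 3) ≤ 2 * #P ∧ #(P + P) + 2 ^ m ≤ 2 ^ (m + 3) := by
  let P : Finset (Fin (m + 3) → ZMod 2) := univ.filter fun x =>
    (x 0 = 0 ∧ x 1 = 0) ∨ (x 0 = 0 ∧ x 2 = 0) ∨ (x 1 = 0 ∧ x 2 = 0)
  have hP : ∀ x, x ∈ P ↔ (x 0 = 0 ∧ x 1 = 0) ∨ (x 0 = 0 ∧ x 2 = 0) ∨ (x 1 = 0 ∧ x 2 = 0) :=
    fun x => by simp [P]
  let t : (Fin m → ZMod 2) → Fin (m + 3) → ZMod 2 := fun x => Fin.cons 1 (Fin.cons 1 (Fin.cons 1 x))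
  have t0 : ∀ x, t x 0 = 1 := fun _ => rfl
  have t1 : ∀ x, t x 1 = 1 := fun _ => rfl
  have t2 : ∀ x, t x 2 = 1 := fun _ => rfl
  have h2 : 2 % (m + 3) = 2 := Nat.mod_eq_of_lt (by omega)
  refine ⟨P, ⟨(hP _).2 (by simp), fun i => (hP _).2 ?_⟩, ?_, ?_⟩
  · by_cases h0 : i = 0
    · subst h0
      exact Or.inr (Or.inr ⟨Pi.single_eq_of_ne (by simp) _,
        Pi.single_eq_of_ne (by simp [Fin.ext_iff, h2]) _⟩)
    · by_cases h1 : i = 1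
      · subst h1
        exact Or.inr (Or.inl ⟨Pi.single_eq_of_ne (Ne.symm h0) _,
          Pi.single_eq_of_ne (by simp [Fin.ext_iff, h2]) _⟩)
      · exact Or.inl ⟨Pi.single_eq_of_ne (Ne.symm h0) _, Pi.single_eq_of_ne (Ne.symm h1) _⟩
  · -- a point or its translate by `(1, 1, 1, 0, …)` lies in `P`
    have huniv : P ∪ (t 0 +ᵥ P) = univ := by
      rw [eq_univ_iff_forall]
      intro x
      rw [mem_union]
      by_cases hx : x ∈ P
      · exact Or.inl hx
      · refine Or.inr (mem_vadd_finset.2 ⟨t 0 + x, ?_, add_cancel_mid cube_add_self _ _⟩)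
        rw [hP] at hx ⊢
        rw [Pi.add_apply, Pi.add_apply, Pi.add_apply, t0, t1, t2]
        generalize x 0 = a at *
        generalize x 1 = b at *
        generalize x 2 = c at *
        revert a b c
        decide
    have := card_union_le P (t 0 +ᵥ P)
    rw [huniv, card_univ, card_cube, card_vadd_finset] at this
    omega
  · have hinj : Function.Injective t := fun x y h =>
      (Fin.cons_injective2 (Fin.cons_injective2 (Fin.cons_injective2 h).2).2).2
    have hdisj : Disjoint (P + P) (univ.image t) := by
      rw [disjoint_left]
      intro z hz hz'
      obtain ⟨w, -, rfl⟩ := mem_image.1 hz'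
      obtain ⟨x, hx, y, hy, e⟩ := mem_add.1 hz
      rw [hP] at hx hy
      have e0 : x 0 + y 0 = 1 := congrFun e 0
      have e1 : x 1 + y 1 = 1 := congrFun e 1
      have e2 : x 2 + y 2 = 1 := congrFun e 2
      rcases hx with ⟨h, h'⟩ | ⟨h, h'⟩ | ⟨h, h'⟩ <;> simp_all
    have := card_le_univ ((P + P) ∪ univ.image t)
    rwa [card_union_of_disjoint hdisj, card_image_of_injective _ hinj, card_univ, card_cube,
      card_cube] at this

lemma IsCoveringConstant.le {K C : ℝ} (hK : 1 ≤ K) (hC : IsCoveringConstant K C) : K ≤ C := by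
  rw [← mul_one C]
  refine hC.le_mul (by linarith) one_pos fun n _ =>
    ⟨univ, ⟨mem_univ _, fun _ => mem_univ _⟩, ?_, ?_⟩
  · have : (0 : ℝ) < 2 ^ n := by positivity
    rw [card_univ, card_cube]
    push_cast
    nlinarith
  · have := card_le_univ ((univ : Finset (Fin n → ZMod 2)) + univ)
    rw [card_cube] at this
    rw [one_mul]
    exact_mod_cast this

lemma IsCoveringConstant.eight_sevenths_mul_le {K C : ℝ} (hK : 7 / 4 ≤ K)
    (hC : IsCoveringConstant K C) : 8 / 7 * K ≤ C := by
  suffices K ≤ C * (7 / 8) by linarith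
  refine hC.le_mul (by linarith) (by norm_num) fun n hn => ?_
  obtain ⟨m, rfl⟩ := Nat.exists_eq_add_of_le' hn
  obtain ⟨P, hb, hP, hPP⟩ := exists_containsBasis_card_add_le m
  have hP : (2 ^ (m + 3) : ℝ) ≤ 2 * #P := by exact_mod_cast hP
  have hPP : (#(P + P) + 2 ^ m : ℝ) ≤ 2 ^ (m + 3) := by exact_mod_cast hPP
  have : (0 : ℝ) < 2 ^ m := by positivity
  rw [pow_add] at hP hPP
  refine ⟨P, hb, ?_, ?_⟩
  · rw [pow_add]; nlinarith
  · rw [pow_add]; linarith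

theorem theorem1p8 (K : ℝ) :
    (1 ≤ K → K < 7 / 4 →
      IsLeast {C : ℝ | IsCoveringConstant K C} (greenTaoConstant K) ∧
        greenTaoConstant K = K) ∧
    (7 / 4 ≤ K → K < 2 →
      IsLeast {C : ℝ | IsCoveringConstant K C} (greenTaoConstant K) ∧
        greenTaoConstant K = 8 / 7 * K) := by
  have key : ∀ F : ℝ, IsLeast {C : ℝ | IsCoveringConstant K C} F →
      IsLeast {C : ℝ | IsCoveringConstant K C} (greenTaoConstant K) ∧ greenTaoConstant K = F := by
    intro F hF
    have h : greenTaoConstant K = F := hF.csInf_eq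
    exact ⟨h ▸ hF, h⟩
  refine ⟨fun h₁ h₂ => key _ ⟨isCoveringConstant_self h₁ h₂, fun C hC => hC.le h₁⟩,
    fun h₁ h₂ => key _ ⟨isCoveringConstant_eight_sevenths (by linarith) h₂,
      fun C hC => hC.eight_sevenths_mul_le h₁⟩⟩
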